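/- An $(n,k)$-Sperner partition system is a set of partitions of an $n$-set such that each partition has exactly $k$ nonempty parts and no part of any partition is a subset of a part of a different partition; it is almost uniform if every part of every partition has size $\lfloor n/k\rfloor$ or $\lceil n/k\rceil$. Let $n,c,k,r$ be integers such that $n=ck+r$, $c\ge 2$, $k\ge 3$ and $1\le r\le k-1$. Suppose that $n=hm$ for positive integers $m$ and $h$ with $m\equiv 0 \pmod c$, and let \[p_1=\left\lfloor\frac{m(h^c-c-1)}{c(k-r)}\right\rfloor,\quad p_2=\left\lfloor\frac{m}{r}\left\lfloor\frac{\binom{h}{c+1}}{\binom{m-1}{c-1}}\right\rfloor\right\rfloor,\quad p_1'=\left\lfloor\frac{mh^c}{c(k-r)}\right\rfloor,\quad p_2'=\left\lfloor\frac{m\binom{h}{c+1}}{r\binom{m-1}{c-1}}\right\rfloor.\] Let $p$ be a nonnegative integer. There exists an almost uniform $(n,k)$-Sperner partition system with exactly $p\binom{m-1}{c-1}$ partitions if (a) $p=\min\{p_1,p_2\}$; or (b) $p=\min\{p_1',p_2'\}$ and $pr\equiv 0\pmod m$. -/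

import Mathlib

/-- An `(n, k)`-Sperner partition system on the `n`-set `Fin n`: a set `S` of partitions of the
ground set (the parts of a `Finpartition` are nonempty), each with exactly `k` parts, such that no
part of a partition in `S` is a subset of a part of a different partition in `S`. -/
structure IsSpernerPartitionSystem (n k : ℕ)
    (S : Finset (Finpartition (Finset.univ : Finset (Fin n)))) : Prop where
  card_parts : ∀ P ∈ S, P.parts.card = k
  not_subset : ∀ P ∈ S, ∀ Q ∈ S, P ≠ Q → ∀ A ∈ P.parts, ∀ B ∈ Q.parts, ¬ A ⊆ B

/-- Every part of every partition in `S` has size `⌊n/k⌋` or `⌈n/k⌉`. -/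
def IsAlmostUniform (n k : ℕ)
    (S : Finset (Finpartition (Finset.univ : Finset (Fin n)))) : Prop :=
  ∀ P ∈ S, ∀ A ∈ P.parts, A.card = ⌊(n : ℚ) / (k : ℚ)⌋₊ ∨ A.card = ⌈(n : ℚ) / (k : ℚ)⌉₊

/-- `p₁ = ⌊m (h ^ c - c - 1) / (c (k - r))⌋`; the arithmetic is rational, so the value may be
negative (this happens exactly for `h = 1` in the range of interest). -/
def boundP1 (m h c k r : ℕ) : ℤ :=
  ⌊((m : ℚ) * ((h : ℚ) ^ c - (c : ℚ) - 1)) / ((c : ℚ) * ((k : ℚ) - (r : ℚ)))⌋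

/-- `p₂ = ⌊(m / r) ⌊C(h, c + 1) / C(m - 1, c - 1)⌋⌋`. -/
def boundP2 (m h c r : ℕ) : ℤ :=
  ⌊((m : ℚ) / (r : ℚ)) *
    ((⌊(h.choose (c + 1) : ℚ) / ((m - 1).choose (c - 1) : ℚ)⌋ : ℤ) : ℚ)⌋

/-- `p₁' = ⌊m h ^ c / (c (k - r))⌋`. -/
def boundP1' (m h c k r : ℕ) : ℤ :=
  ⌊((m : ℚ) * (h : ℚ) ^ c) / ((c : ℚ) * ((k : ℚ) - (r : ℚ)))⌋

/-- `p₂' = ⌊m C(h, c + 1) / (r C(m - 1, c - 1))⌋`. -/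
def boundP2' (m h c r : ℕ) : ℤ :=
  ⌊((m : ℚ) * (h.choose (c + 1) : ℚ)) / ((r : ℚ) * ((m - 1).choose (c - 1) : ℚ))⌋

/-! Arrange the `n` points in `m` rows of size `h` and split the `c`-subsets of the rows into
parallel classes by `baranyai`. Each parallel class yields `p` partitions. In one of them an edge of
the class gets a number `b`: each of its `c` rows contains `b` parts of size `c + 1`, and the other
`h - (c + 1) * b` points of each row are covered by transversals of the edge. A transversal has
points in two different rows, so it never lies in a `(c + 1)`-set inside a row. The Sperner property
thus only asks that no set be used twice, which is a matter of supply: `h ^ c` transversals per edge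
and `h.choose (c + 1)` sets per row.

It suffices to get these counts right. By `exists_almost_regular`, colours can be exchanged among
sets of the same row type until, in each colour, the degrees of points of a row differ by at most 1.
If their average is 1, every colour class is a partition (`exists_regular`). With a single row this
also proves Baranyai's theorem.

The numbers `b` are spread evenly by `exists_balanced_matrix`; the bounds on `p` then express the
two supply conditions, the rounding being paid for by the `- c - 1` and the inner floor in (a), and
absent in (b). If the even spread overfills a row, `exists_system_of_tight` starts afresh with only
`c` longer rows. -/

/-! ### Balanced signs and almost regular colourings. -/

/-- A finite set with a fixed-point-free involution `ι` can be signed so that `ι` changes signs and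
the signs in each colour class almost cancel. -/
theorem exists_balanced_sign {α C : Type*} [DecidableEq α] [DecidableEq C] (γ : α → C)
    (E : Finset α) : ∀ ι : α → α, (∀ e ∈ E, ι e ∈ E) → (∀ e ∈ E, ι (ι e) = e) →
      (∀ e ∈ E, ι e ≠ e) →
      ∃ s : α → ℤ, (∀ e ∈ E, s e = 1 ∨ s e = -1) ∧ (∀ e ∈ E, s (ι e) = - s e) ∧
        ∀ c, |∑ e ∈ E with γ e = c, s e| ≤ 1 := by
  induction E using Finset.strongInduction with
  | H E ih =>
  intro ι hE hι hne
  rcases E.eq_empty_or_nonempty with rfl | ⟨e, he⟩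
  · exact ⟨fun _ => 1, by simp, by simp, by simp⟩
  have hinj : ∀ a ∈ E, ∀ b ∈ E, ι a = ι b → a = b := fun a ha b hb hab => by
    rw [← hι a ha, ← hι b hb, hab]
  -- splitting off two elements from the sum over a colour class
  have split : ∀ (a b : α) (s : α → ℤ) (c : C), a ∈ E → b ∈ E → a ≠ b →
      ∑ x ∈ E with γ x = c, s x =
        (if γ a = c then s a else 0) + (if γ b = c then s b else 0) +
          ∑ x ∈ (E.erase a).erase b with γ x = c, s x := by
    intro a b s c ha hb hab
    simp only [Finset.sum_filter]
    rw [← Finset.add_sum_erase E _ ha,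
      ← Finset.add_sum_erase (E.erase a) _ (Finset.mem_erase.2 ⟨hab.symm, hb⟩), add_assoc]
  have hsub : ∀ a b : α, a ∈ E → (E.erase a).erase b ⊂ E := fun a b ha =>
    lt_of_le_of_lt (Finset.erase_subset _ _) (Finset.erase_ssubset ha)
  have hf := hE e he
  have hfe := hne e he
  -- restriction to the complement of an orbit
  obtain ⟨s, hs1, hs2, hs3⟩ := ih _ (hsub e (ι e) he) ι
    (fun x hx => by
      simp only [Finset.mem_erase] at hx ⊢
      exact ⟨fun h => hx.2.1 (hinj _ hx.2.2 _ he h),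
        fun h => hx.1 (by rw [← h, hι x hx.2.2]), hE x hx.2.2⟩)
    (fun x hx => hι x (Finset.mem_of_mem_erase (Finset.mem_of_mem_erase hx)))
    (fun x hx => hne x (Finset.mem_of_mem_erase (Finset.mem_of_mem_erase hx)))
  have extend : ∀ u : ℤ, (u = 1 ∨ u = -1) →
      ∃ s' : α → ℤ, (∀ e ∈ E, s' e = 1 ∨ s' e = -1) ∧ (∀ e ∈ E, s' (ι e) = - s' e) ∧
        ∀ c, ∑ x ∈ E with γ x = c, s' x =
          (if γ e = c then -u else 0) + (if γ (ι e) = c then u else 0) +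
          ∑ x ∈ (E.erase e).erase (ι e) with γ x = c, s x := by
    intro u hu
    refine ⟨fun x => if x = e then -u else if x = ι e then u else s x, ?_, ?_, ?_⟩
    · intro x hx
      by_cases h1 : x = e
      · simp only [h1, if_true]; omega
      by_cases h2 : x = ι e
      · simp only [h2, if_true, hfe, if_false]; omega
      simpa only [h1, h2, if_false] using hs1 x (by simp [h1, h2, hx])
    · intro x hx
      by_cases h1 : x = e
      · subst h1; simp [hfe]
      by_cases h2 : x = ι e
      · subst h2; simp [hfe, hι e he]
      have h3 : ι x ≠ e := fun h => h2 (by rw [← h, hι x hx])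
      have h4 : ι x ≠ ι e := fun h => h1 (hinj _ hx _ he h)
      simpa only [h1, h2, h3, h4, if_false] using hs2 x (by simp [h1, h2, hx])
    · intro c
      rw [split e (ι e) _ c he hf hfe.symm]
      simp only [if_true, hfe, if_false]
      congr 1
      refine Finset.sum_congr rfl fun x hx => ?_
      simp only [Finset.mem_filter, Finset.mem_erase] at hx
      simp [hx.1.1, hx.1.2.1]
  -- A colour-mate `g` of `e` is to receive the opposite sign, so that the two cancel in their
  -- class. If `g = ι e` this is automatic; otherwise it amounts to opposite signs on `ι e` and `ι
  -- g`.
  by_cases hg : ∃ g ∈ E, g ≠ e ∧ γ g = γ e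
  · obtain ⟨g, hgE, hge, hγ⟩ := hg
    by_cases hgf : g = ι e
    · obtain ⟨s', h1, h2, h3⟩ := extend 1 (Or.inl rfl)
      refine ⟨s', h1, h2, fun c => ?_⟩
      have := hs3 c
      rw [h3, ← hgf, hγ]
      split_ifs <;> simpa [hgf] using this
    -- remove `e` and `g`, and match their partners with each other
    have hgf' : ι g ≠ e := fun h => hgf (by rw [← h, hι g hgE])
    have hιne : ι e ≠ ι g := fun h => hge (hinj _ hgE _ he h.symm)
    obtain ⟨s, hs1, hs2, hs3⟩ := ih _ (hsub e g he)
      (fun x => if x = ι e then ι g else if x = ι g then ι e else ι x)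
      (fun x hx => by
        simp only [Finset.mem_erase] at hx ⊢
        by_cases h1 : x = ι e
        · simp only [h1, if_true]; exact ⟨hne g hgE, hgf', hE g hgE⟩
        by_cases h2 : x = ι g
        · simp only [h2, if_true, hιne.symm, if_false]; exact ⟨Ne.symm hgf, hfe, hf⟩
        simp only [h1, h2, if_false]
        exact ⟨fun h => h2 (by rw [← h, hι x hx.2.2]), fun h => h1 (by rw [← h, hι x hx.2.2]),
          hE x hx.2.2⟩)
      (fun x hx => by
        simp only [Finset.mem_erase] at hx
        by_cases h1 : x = ι e
        · simp only [h1, if_true, hιne.symm, if_false]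
        by_cases h2 : x = ι g
        · simp only [h2, if_true, hιne.symm, if_false]
        have h3 : ι x ≠ ι e := fun h => hx.2.1 (hinj _ hx.2.2 _ he h)
        have h4 : ι x ≠ ι g := fun h => hx.1 (hinj _ hx.2.2 _ hgE h)
        simp only [h1, h2, h3, h4, if_false]
        exact hι x hx.2.2)
      (fun x hx => by
        simp only [Finset.mem_erase] at hx
        by_cases h1 : x = ι e
        · simp only [h1, if_true]; exact hιne.symm
        by_cases h2 : x = ι g
        · simp only [h2, if_true, hιne.symm, if_false]; exact hιne
        simp only [h1, h2, if_false]
        exact hne x hx.2.2)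
    have hfm : ι e ∈ (E.erase e).erase g := by simp [Ne.symm hgf, hfe, hf]
    have hgm : ι g ∈ (E.erase e).erase g := by simp [hgf', hne g hgE, hE g hgE]
    have hfg : s (ι g) = - s (ι e) := by simpa using hs2 _ hfm
    refine ⟨fun x => if x = e then - s (ι e) else if x = g then s (ι e) else s x, ?_, ?_, ?_⟩
    · have := hs1 _ hfm
      intro x hx
      by_cases h1 : x = e
      · simp only [h1, if_true]; omega
      by_cases h2 : x = g
      · simp only [h2, if_true, hge, if_false]; omega
      simpa only [h1, h2, if_false] using hs1 x (by simp [h1, h2, hx])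
    · intro x hx
      by_cases h1 : x = e
      · subst h1; simp [hfe, Ne.symm hgf]
      by_cases h2 : x = g
      · subst h2; simp [hge, hgf', hne x hx, hfg]
      by_cases h3 : x = ι e
      · subst h3; simp [hfe, hι e he, Ne.symm hgf]
      by_cases h4 : x = ι g
      · subst h4; simp [hgf', hι g hgE, hge, hfg, hne g hgE]
      have h5 : ι x ≠ e := fun h => h3 (by rw [← h, hι x hx])
      have h6 : ι x ≠ g := fun h => h4 (by rw [← h, hι x hx])
      simpa only [h1, h2, h3, h4, h5, h6, if_false] using hs2 x (by simp [h1, h2, hx])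
    · intro c
      rw [split e g _ c he hgE hge.symm]
      have : ∑ x ∈ (E.erase e).erase g with γ x = c,
          (fun x => if x = e then - s (ι e) else if x = g then s (ι e) else s x) x =
          ∑ x ∈ (E.erase e).erase g with γ x = c, s x := by
        refine Finset.sum_congr rfl fun x hx => ?_
        simp only [Finset.mem_filter, Finset.mem_erase] at hx
        simp [hx.1.1, hx.1.2.1]
      rw [this]
      simp only [if_true, hge, if_false, hγ]
      have := hs3 c
      split_ifs <;> simpa using this
  · push Not at hg
    -- `e` is alone in its colour class, so the sign of its partner can be chosen freely
    have hcl : ∀ c, γ e = c → ∑ x ∈ (E.erase e).erase (ι e) with γ x = c, s x = 0 := by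
      intro c hc
      refine Finset.sum_eq_zero fun x hx => ?_
      simp only [Finset.mem_filter, Finset.mem_erase] at hx
      exact absurd (hx.2.trans hc.symm) (hg x hx.1.2.2 hx.1.2.1)
    have hfγ := hg (ι e) hf hfe
    set S := ∑ x ∈ (E.erase e).erase (ι e) with γ x = γ (ι e), s x with hS
    have hSb := abs_le.1 (hs3 (γ (ι e)))
    rw [← hS] at hSb
    obtain ⟨s', h1, h2, h3⟩ := extend (if S ≤ 0 then 1 else -1) (by split_ifs <;> simp)
    refine ⟨s', h1, h2, fun c => ?_⟩
    rw [h3]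
    by_cases hce : γ e = c
    · rw [hcl c hce]
      have : γ (ι e) ≠ c := fun h => hfγ (h.trans hce.symm)
      simp only [hce, this, if_true, if_false]
      split_ifs <;> simp
    · by_cases hcf : γ (ι e) = c
      · subst hcf
        simp only [hce, if_true, if_false, ← hS]
        rw [abs_le]
        split_ifs <;> constructor <;> omega
      · simpa [hce, hcf] using hs3 c

/-- The number of sets of colour `c` that contain `x`. -/
def colourDegree {V C : Type*} [Fintype V] [DecidableEq V] [DecidableEq C]
    (γ : Finset V → C) (c : C) (x : V) : ℕ :=
  (Finset.univ.filter fun e => γ e = c ∧ x ∈ e).card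

/-- The multiset of rows which a set meets. -/
def rowType {V I : Type*} (ρ : V → I) (e : Finset V) : Multiset I := e.val.map ρ

/-- Any two vertices in a common row can be balanced in all colours at once. -/
theorem exists_balanced_pair {V I C : Type*} [Fintype V] [DecidableEq V] [DecidableEq I]
    [DecidableEq C] (ρ : V → I) (γ : Finset V → C) {x y : V} (hxy : x ≠ y) (hρ : ρ x = ρ y) :
    ∃ γ' : Finset V → C,
      (∀ t c, (Finset.univ.filter fun e => rowType ρ e = t ∧ γ' e = c).card =
        (Finset.univ.filter fun e => rowType ρ e = t ∧ γ e = c).card) ∧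
      (∀ c v, v ≠ x → v ≠ y → colourDegree γ' c v = colourDegree γ c v) ∧
      (∀ c, colourDegree γ' c x + colourDegree γ' c y =
        colourDegree γ c x + colourDegree γ c y) ∧
      ∀ c, |(colourDegree γ' c x : ℤ) - colourDegree γ' c y| ≤ 1 := by
  set ι : Finset V → Finset V := fun e => e.map (Equiv.swap x y).toEmbedding with hι
  have mem_ι : ∀ e v, v ∈ ι e ↔ Equiv.swap x y v ∈ e := by
    intro e v
    simp only [hι, Finset.mem_map_equiv, Equiv.symm_swap]
  have hx : ∀ e, x ∈ ι e ↔ y ∈ e := fun e => by simp [mem_ι]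
  have hy : ∀ e, y ∈ ι e ↔ x ∈ e := fun e => by simp [mem_ι]
  have hv : ∀ e v, v ≠ x → v ≠ y → (v ∈ ι e ↔ v ∈ e) := fun e v h1 h2 => by
    rw [mem_ι, Equiv.swap_apply_of_ne_of_ne h1 h2]
  have hιι : ∀ e, ι (ι e) = e := fun e => by
    ext v; simp [mem_ι]
  have htype : ∀ e, rowType ρ (ι e) = rowType ρ e := by
    intro e
    simp only [rowType, hι, Finset.map_val, Multiset.map_map]
    refine Multiset.map_congr rfl fun v _ => ?_
    simp only [Function.comp, Equiv.coe_toEmbedding]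
    rcases eq_or_ne v x with rfl | h1
    · simp [hρ]
    rcases eq_or_ne v y with rfl | h2
    · simp [hρ]
    rw [Equiv.swap_apply_of_ne_of_ne h1 h2]
  have hfix : ∀ e, (x ∈ e ↔ y ∈ e) → ι e = e := by
    intro e h
    ext v
    rcases eq_or_ne v x with rfl | h1
    · rw [hx, h]
    rcases eq_or_ne v y with rfl | h2
    · rw [hy, h]
    exact hv e v h1 h2
  -- Swapping `x` and `y` pairs up the sets containing exactly one of them. Sign `1` will mean that
  -- the colour of the set goes to the member of its pair containing `x`, so a class sum of signs is
  -- the difference of the degrees of `x` and `y`.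
  obtain ⟨s, hs1, hs2, hs3⟩ := exists_balanced_sign γ
    (Finset.univ.filter fun e : Finset V => ¬ (x ∈ e ↔ y ∈ e)) ι
    (fun e he => by simp only [Finset.mem_filter, Finset.mem_univ, true_and, hx, hy] at he ⊢; tauto)
    (fun e _ => hιι e)
    (fun e he h => by
      simp only [Finset.mem_filter, Finset.mem_univ, true_and] at he
      apply he
      conv_lhs => rw [← h]
      exact hx e)
  simp only [Finset.mem_filter, Finset.mem_univ, true_and] at hs1 hs2
  set π : Finset V → Finset V := fun e => if (x ∈ e ↔ s e = 1) then e else ι e with hπ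
  have hπfix : ∀ e, (x ∈ e ↔ y ∈ e) → π e = e := fun e h => by
    simp only [hπ]; split_ifs
    · rfl
    · exact hfix e h
  have hππ : ∀ e, π (π e) = e := by
    intro e
    by_cases h : x ∈ e ↔ y ∈ e
    · rw [hπfix e h, hπfix e h]
    by_cases h1 : x ∈ e ↔ s e = 1
    · have : π e = e := by simp only [hπ, if_pos h1]
      rw [this, this]
    · have h2 : π e = ι e := by simp only [hπ, if_neg h1]
      have h3 : ¬ (x ∈ ι e ↔ s (ι e) = 1) := by
        rw [hx, hs2 e h]
        have := hs1 e h
        have h5 : (- s e = 1) ↔ ¬ s e = 1 := by omega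
        rw [h5]; tauto
      rw [h2]
      simp only [hπ, if_neg h3, hιι]
  have hπv : ∀ e v, v ≠ x → v ≠ y → (v ∈ π e ↔ v ∈ e) := fun e v h1 h2 => by
    simp only [hπ]; split_ifs
    · rfl
    · exact hv e v h1 h2
  have hπtype : ∀ e, rowType ρ (π e) = rowType ρ e := fun e => by
    simp only [hπ]; split_ifs
    · rfl
    · exact htype e
  have hdeg : ∀ c v, colourDegree (fun e => γ (π e)) c v =
      (Finset.univ.filter fun e => γ e = c ∧ v ∈ π e).card := by
    intro c v
    unfold colourDegree
    refine Finset.card_nbij' π π ?_ ?_ (fun e _ => hππ e) (fun e _ => hππ e)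
    · intro e he; simpa [hππ] using he
    · intro e he; simpa [hππ] using he
  have hind : ∀ c v, ((Finset.univ.filter fun e => γ e = c ∧ v ∈ π e).card : ℤ) =
      ∑ e with γ e = c, if v ∈ π e then 1 else 0 := by
    intro c v
    rw [← Finset.filter_filter, Finset.card_filter]; push_cast; rfl
  have hind' : ∀ c v, (colourDegree γ c v : ℤ) =
      ∑ e with γ e = c, if v ∈ e then 1 else 0 := by
    intro c v
    rw [colourDegree, ← Finset.filter_filter, Finset.card_filter]; push_cast; rfl
  have hxmem : ∀ e, ¬ (x ∈ e ↔ y ∈ e) → (x ∈ π e ↔ s e = 1) := by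
    intro e h
    by_cases h1 : x ∈ e ↔ s e = 1
    · simp only [hπ, if_pos h1]; exact h1
    · simp only [hπ, if_neg h1, hx]; tauto
  have hymem : ∀ e, ¬ (x ∈ e ↔ y ∈ e) → (y ∈ π e ↔ ¬ s e = 1) := by
    intro e h
    by_cases h1 : x ∈ e ↔ s e = 1
    · simp only [hπ, if_pos h1]; tauto
    · simp only [hπ, if_neg h1, hy]; tauto
  refine ⟨fun e => γ (π e), ?_, ?_, ?_, ?_⟩
  · intro t c
    refine Finset.card_nbij' π π ?_ ?_ (fun e _ => hππ e) (fun e _ => hππ e)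
    · intro e he; simpa [hππ, hπtype] using he
    · intro e he; simpa [hππ, hπtype] using he
  · intro c v h1 h2
    rw [hdeg, colourDegree]
    simp only [hπv _ v h1 h2]
  · intro c
    zify
    rw [hdeg, hdeg, hind, hind, hind', hind', ← Finset.sum_add_distrib, ← Finset.sum_add_distrib]
    refine Finset.sum_congr rfl fun e _ => ?_
    by_cases h : x ∈ e ↔ y ∈ e
    · rw [hπfix e h]
    · simp only [hxmem e h, hymem e h]
      by_cases h1 : s e = 1 <;> by_cases h2 : x ∈ e <;> simp_all
  · intro c
    rw [hdeg, hdeg, hind, hind, ← Finset.sum_sub_distrib]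
    convert hs3 c using 2
    rw [Finset.filter_filter, Finset.sum_filter, Finset.sum_filter]
    refine Finset.sum_congr rfl fun e _ => ?_
    by_cases hc : γ e = c
    · by_cases h : x ∈ e ↔ y ∈ e
      · rw [hπfix e h]; simp [h]
      · simp only [hxmem e h, hymem e h]
        have := hs1 e h
        simp only [h, hc, not_false_eq_true, and_self, if_true]
        rcases this with h' | h' <;> rw [h'] <;> norm_num
    · simp [hc]

/-- Every colouring of the sets of vertices can be changed, keeping the number of sets of each
row type and colour, so that vertices in the same row have almost equal degrees in each colour. -/
theorem exists_almost_regular {V I C : Type*} [Fintype V] [DecidableEq V] [DecidableEq I]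
    [DecidableEq C] [Fintype C] (ρ : V → I) (γ₀ : Finset V → C) :
    ∃ γ : Finset V → C,
      (∀ t c, (Finset.univ.filter fun e => rowType ρ e = t ∧ γ e = c).card =
        (Finset.univ.filter fun e => rowType ρ e = t ∧ γ₀ e = c).card) ∧
      ∀ c x y, ρ x = ρ y → colourDegree γ c x ≤ colourDegree γ c y + 1 := by
  set S : Set (Finset V → C) := {γ | ∀ t c,
    (Finset.univ.filter fun e => rowType ρ e = t ∧ γ e = c).card =
        (Finset.univ.filter fun e => rowType ρ e = t ∧ γ₀ e = c).card}
  -- In a colouring minimising the sum of squared degrees, a gap of 2 or more could be balanced.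
  -- Balancing acts on all colours at once, but increases the sum of squares in none.
  obtain ⟨γ, hγS, hmin⟩ := Set.exists_min_image S
    (fun γ => ∑ c, ∑ v, (colourDegree γ c v) ^ 2) (Set.toFinite S) ⟨γ₀, fun _ _ => rfl⟩
  refine ⟨γ, hγS, fun c x y hρ => ?_⟩
  by_contra! hlt
  have hxy : x ≠ y := by rintro rfl; omega
  obtain ⟨γ', h1, h2, h3, h4⟩ := exists_balanced_pair ρ γ hxy hρ
  refine absurd (hmin γ' fun t c => (h1 t c).trans (hγS t c)) (not_le.2 ?_)
  have split : ∀ (δ : Finset V → C) c, ∑ v, (colourDegree δ c v) ^ 2 =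
      colourDegree δ c x ^ 2 + colourDegree δ c y ^ 2 +
        ∑ v ∈ (Finset.univ.erase x).erase y, (colourDegree δ c v) ^ 2 := by
    intro δ c
    rw [← Finset.add_sum_erase _ _ (Finset.mem_univ x),
      ← Finset.add_sum_erase (Finset.univ.erase x) _
        (Finset.mem_erase.2 ⟨hxy.symm, Finset.mem_univ y⟩), add_assoc]
  have hrest : ∀ c, ∑ v ∈ (Finset.univ.erase x).erase y, (colourDegree γ' c v) ^ 2 =
      ∑ v ∈ (Finset.univ.erase x).erase y, (colourDegree γ c v) ^ 2 := by
    intro c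
    refine Finset.sum_congr rfl fun v hv => ?_
    simp only [Finset.mem_erase] at hv
    rw [h2 c v hv.2.1 hv.1]
  have key : ∀ {a b a' b' : ℕ}, a' + b' = a + b → |(a' : ℤ) - b'| ≤ 1 →
      a' ^ 2 + b' ^ 2 ≤ a ^ 2 + b ^ 2 ∧ (b + 1 < a → a' ^ 2 + b' ^ 2 < a ^ 2 + b ^ 2) := by
    intro a b a' b' hs hd
    zify at hs ⊢
    have e1 : 2 * ((a' : ℤ) ^ 2 + b' ^ 2) = (a + b : ℤ) ^ 2 + ((a' : ℤ) - b') ^ 2 := by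
      rw [← hs]; ring
    have e2 : 2 * ((a : ℤ) ^ 2 + b ^ 2) = (a + b : ℤ) ^ 2 + ((a : ℤ) - b) ^ 2 := by ring
    have e3 : ((a' : ℤ) - b') ^ 2 ≤ 1 := by
      rw [abs_le] at hd; nlinarith
    refine ⟨?_, fun h => ?_⟩
    · rcases eq_or_ne (a : ℤ) b with h | h
      · have : ((a' : ℤ) - b') = 0 := by
          rw [abs_le] at hd; omega
        rw [this] at e1
        nlinarith [sq_nonneg ((a : ℤ) - b)]
      · have : 1 ≤ ((a : ℤ) - b) ^ 2 := by
          have : (a : ℤ) - b ≠ 0 := sub_ne_zero.2 h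
          have := pow_pos (abs_pos.2 this) 2
          rw [sq_abs] at this; omega
        omega
    · have : 4 ≤ ((a : ℤ) - b) ^ 2 := by nlinarith
      omega
  refine Finset.sum_lt_sum (fun d _ => ?_) ⟨c, Finset.mem_univ c, ?_⟩
  · rw [split, split, hrest]
    exact Nat.add_le_add_right (key (h3 d) (h4 d)).1 _
  · rw [split, split, hrest]
    exact Nat.add_lt_add_right ((key (h3 c) (h4 c)).2 hlt) _

/-! ### Prescribed row types and regular colourings. -/

/-- A partial colouring of a finite type with prescribed numbers of elements of each label and
colour exists as soon as each label occurs often enough. -/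
theorem exists_prescribed_colouring {A L C : Type*} [Fintype A] [DecidableEq L] [Fintype C]
    [DecidableEq C] (τ : A → L) (w : L → C → ℕ)
    (hw : ∀ l, ∑ c, w l c ≤ (Finset.univ.filter fun a => τ a = l).card) :
    ∃ γ : A → Option C, ∀ l c,
      (Finset.univ.filter fun a => τ a = l ∧ γ a = some c).card = w l c := by
  classical
  have hemb : ∀ l, Nonempty ((Σ c, Fin (w l c)) ↪ {a // τ a = l}) := by
    intro l
    refine Function.Embedding.nonempty_of_card_le ?_
    rw [Fintype.card_sigma, Fintype.card_subtype]
    simpa using hw l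
  let g : ∀ l, (Σ c, Fin (w l c)) ↪ {a // τ a = l} := fun l => (hemb l).some
  -- Each label class contains disjoint blocks of sizes `w l c`, one per colour; elements outside
  -- the blocks stay uncoloured.
  refine ⟨fun a => if hx : ∃ x : Σ c, Fin (w (τ a) c), (g (τ a) x).1 = a
    then some hx.choose.1 else none, fun l c => ?_⟩
  have : (Finset.univ.filter fun a => τ a = l ∧
      (if hx : ∃ x : Σ c, Fin (w (τ a) c), (g (τ a) x).1 = a
        then some hx.choose.1 else none) = some c) =
      (Finset.univ : Finset (Fin (w l c))).map
        ⟨fun j => (g l ⟨c, j⟩).1, fun i j hij => by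
          have := (g l).injective (Subtype.ext hij)
          simpa using this⟩ := by
    ext a
    simp only [Finset.mem_filter, Finset.mem_univ, true_and, Finset.mem_map]
    constructor
    · rintro ⟨rfl, h⟩
      split_ifs at h with hx
      have h1 := hx.choose_spec
      generalize hx.choose = z at h h1
      have h2 := Option.some.inj h
      exact ⟨Fin.cast (by rw [← h2]) z.2, by subst h2; exact h1⟩
    · rintro ⟨j, hj⟩
      have ht : τ a = l := hj ▸ (g l ⟨c, j⟩).2
      subst ht
      have hx : ∃ x : Σ c, Fin (w (τ a) c), (g (τ a) x).1 = a := ⟨⟨c, j⟩, hj⟩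
      refine ⟨rfl, ?_⟩
      rw [dif_pos hx, (g (τ a)).injective (Subtype.ext (hx.choose_spec.trans hj.symm))]
  rw [this, Finset.card_map, Finset.card_univ, Fintype.card_fin]

/-- Grouping by row type shows that only the preserved counts matter; this carries the total degree
of a row over to the regularised colouring. -/
theorem sum_colour_class_eq {V I C : Type*} [Fintype V] [DecidableEq V] [DecidableEq I]
    [DecidableEq C] {ρ : V → I} {γ γ' : Finset V → C}
    (h : ∀ t c, (Finset.univ.filter fun e => rowType ρ e = t ∧ γ e = c).card =
      (Finset.univ.filter fun e => rowType ρ e = t ∧ γ' e = c).card)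
    (c : C) (g : Multiset I → ℕ) :
    ∑ e with γ e = c, g (rowType ρ e) = ∑ e with γ' e = c, g (rowType ρ e) := by
  have key : ∀ δ : Finset V → C, ∑ e with δ e = c, g (rowType ρ e) =
      ∑ t ∈ (Finset.univ : Finset (Finset V)).image (rowType ρ),
        (Finset.univ.filter fun e => rowType ρ e = t ∧ δ e = c).card * g t := by
    intro δ
    rw [← Finset.sum_fiberwise_of_maps_to (s := Finset.univ.filter fun e => δ e = c)
      (t := (Finset.univ : Finset (Finset V)).image (rowType ρ)) (g := rowType ρ)
      (fun e _ => Finset.mem_image_of_mem _ (Finset.mem_univ e))]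
    refine Finset.sum_congr rfl fun t _ => ?_
    rw [Finset.filter_filter, Finset.sum_congr rfl (g := fun _ => g t)]
    · simp [and_comm]
    · intro e he
      simp only [Finset.mem_filter] at he
      rw [he.2.2]
  rw [key, key]
  exact Finset.sum_congr rfl fun t _ => by rw [h]

/-- Double counting of incidences between points of a row and sets of a colour. -/
theorem sum_colourDegree_row {V I C : Type*} [Fintype V] [DecidableEq V] [DecidableEq I]
    [DecidableEq C] (ρ : V → I) (γ : Finset V → C) (c : C) (i : I) :
    ∑ v with ρ v = i, colourDegree γ c v = ∑ e with γ e = c, (rowType ρ e).count i := by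
  have h1 : ∀ v, colourDegree γ c v = ∑ e with γ e = c, if v ∈ e then 1 else 0 := by
    intro v
    rw [colourDegree, ← Finset.filter_filter, Finset.card_filter]
  simp only [h1]
  rw [Finset.sum_comm]
  refine Finset.sum_congr rfl fun e _ => ?_
  rw [← Finset.card_filter, rowType, Multiset.count_map, Finset.filter_filter,
    ← Finset.filter_val, Finset.card_val]
  congr 1
  ext v
  simp [and_comm, eq_comm]

/-- If the total degree on each row, in each colour, is the size of the row, then the colour
classes can be made into partitions of the vertex set. -/
theorem exists_regular {V I C : Type*} [Fintype V] [DecidableEq V] [DecidableEq I]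
    [DecidableEq C] [Fintype C] (ρ : V → I) (γ₀ : Finset V → Option C)
    (hγ : ∀ c v, ∑ e with γ₀ e = some c, (rowType ρ e).count (ρ v) =
      (Finset.univ.filter fun w => ρ w = ρ v).card) :
    ∃ γ : Finset V → Option C,
      (∀ t c, (Finset.univ.filter fun e => rowType ρ e = t ∧ γ e = c).card =
        (Finset.univ.filter fun e => rowType ρ e = t ∧ γ₀ e = c).card) ∧
      ∀ c v, ∃! e, γ e = some c ∧ v ∈ e := by
  obtain ⟨γ, h1, h2⟩ := exists_almost_regular ρ γ₀
  refine ⟨γ, h1, fun c v => ?_⟩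
  have hsum : ∑ w with ρ w = ρ v, colourDegree γ (some c) w =
      ∑ w with ρ w = ρ v, 1 := by
    rw [sum_colourDegree_row, sum_colour_class_eq h1 (some c) fun t => t.count (ρ v), hγ,
      Finset.card_eq_sum_ones]
  have hdeg : colourDegree γ (some c) v = 1 := by
    -- The degrees on the row average 1 and differ by at most 1: a degree 0 would make all of them
    -- at most 1, a degree above 1 all of them at least 1, contradicting the sum.
    by_contra hne
    have hv : v ∈ Finset.univ.filter fun w => ρ w = ρ v := by simp
    rcases Nat.lt_or_gt_of_ne hne with hlt | hgt
    · refine absurd hsum (ne_of_lt (Finset.sum_lt_sum (fun w hw => ?_) ⟨v, hv, hlt⟩))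
      have := h2 (some c) w v (Finset.mem_filter.1 hw).2
      omega
    · refine absurd hsum (ne_of_gt (Finset.sum_lt_sum (fun w hw => ?_) ⟨v, hv, hgt⟩))
      have := h2 (some c) v w (Finset.mem_filter.1 hw).2.symm
      omega
  obtain ⟨e, he⟩ := Finset.card_eq_one.1 hdeg
  have hmem : ∀ e', (γ e' = some c ∧ v ∈ e') ↔ e' = e := fun e' => by
    rw [← Finset.mem_singleton (b := e') (a := e), ← he]; simp
  exact ⟨e, (hmem e).2 rfl, fun e' he' => (hmem e').1 he'⟩

/-! ### Baranyai's theorem. -/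

/-- **Baranyai's theorem**: the `c`-subsets of an `m`-set can be partitioned into parallel
classes if `c` divides `m`. -/
theorem baranyai {m c : ℕ} (hm : 0 < m) (hc : 0 < c) (hcm : c ∣ m) :
    ∃ β : Finset (Fin m) → Option (Fin ((m - 1).choose (c - 1))),
      (∀ e f, β e = some f → e.card = c) ∧ ∀ f i, ∃! e, β e = some f ∧ i ∈ e := by
  obtain ⟨d, rfl⟩ := hcm
  -- With a single row the row type records only the cardinality. Each colour is given `d` sets of
  -- size `c`, hence total degree `c * d`.
  have htype : ∀ e : Finset (Fin (c * d)),
      rowType (fun _ => ()) e = Multiset.replicate e.card () := fun e => by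
    simp [rowType]
  have hrep : ∀ a b : ℕ, Multiset.replicate a () = Multiset.replicate b () ↔ a = b := fun a b =>
    ⟨fun h => by simpa using congrArg Multiset.card h, fun h => by rw [h]⟩
  have hchoose : (c * d - 1).choose (c - 1) * d = (c * d).choose c := by
    have := Nat.add_one_mul_choose_eq (c * d - 1) (c - 1)
    rw [Nat.sub_add_cancel hm, Nat.sub_add_cancel hc] at this
    refine Nat.eq_of_mul_eq_mul_left hc ?_
    linarith
  have hcount : (Finset.univ.filter fun e : Finset (Fin (c * d)) =>
      rowType (fun _ => ()) e = Multiset.replicate c ()).card = (c * d).choose c := by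
    simp only [htype, hrep]
    rw [Finset.univ_filter_card_eq, Finset.card_powersetCard, Finset.card_univ, Fintype.card_fin]
  obtain ⟨γ₀, hγ₀⟩ := exists_prescribed_colouring
    (rowType (fun _ => ()) : Finset (Fin (c * d)) → Multiset Unit)
    (fun t (_ : Fin ((c * d - 1).choose (c - 1))) => if t = Multiset.replicate c () then d else 0)
    (fun t => by
      by_cases ht : t = Multiset.replicate c ()
      · subst ht
        rw [hcount]
        simp [hchoose]
      · simp [ht])
  have hcard : ∀ e f, γ₀ e = some f → e.card = c := by
    intro e f hef
    by_contra hne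
    have := hγ₀ (rowType (fun _ => ()) e) f
    rw [if_neg (by rw [htype, hrep]; exact hne), Finset.card_eq_zero] at this
    exact absurd (show e ∈ _ from by simp [hef]) (this ▸ Finset.notMem_empty e)
  obtain ⟨β, h1, h2⟩ := exists_regular (fun _ => ()) γ₀ (by
    intro f v
    have : (Finset.univ.filter fun e => γ₀ e = some f).card = d := by
      have := hγ₀ (Multiset.replicate c ()) f
      rw [if_pos rfl] at this
      refine Eq.trans (congrArg Finset.card ?_) this
      ext e
      simp only [Finset.mem_filter, Finset.mem_univ, true_and, htype, hrep]
      exact ⟨fun h => ⟨hcard e f h, h⟩, fun h => h.2⟩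
    rw [Finset.sum_congr rfl (g := fun _ => c)]
    · simp [this, mul_comm]
    · intro e he
      rw [htype, Multiset.count_replicate_self, hcard e f (Finset.mem_filter.1 he).2])
  refine ⟨β, fun e f hef => ?_, h2⟩
  have hpos : 0 < (Finset.univ.filter fun e' =>
      rowType (fun _ => ()) e' = rowType (fun _ => ()) e ∧ β e' = some f).card :=
    Finset.card_pos.2 ⟨e, by simp [hef]⟩
  rw [h1] at hpos
  obtain ⟨e', he'⟩ := Finset.card_pos.1 hpos
  simp only [Finset.mem_filter, Finset.mem_univ, true_and, htype, hrep] at he'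
  rw [← he'.1]
  exact hcard e' f he'.2

/-! ### Transversals and sets inside rows. -/

/-- Summing a function of the row type over a colour class whose row types are prescribed by
weights on labels. -/
theorem sum_class_eq_sum_labels {V I C L : Type*} [Fintype V] [DecidableEq V] [DecidableEq I]
    [DecidableEq C] [Fintype L] (ρ : V → I) (γ : Finset V → C) (x : C) (τ : L → Multiset I)
    (ω : L → ℕ)
    (h : ∀ t, (Finset.univ.filter fun e => rowType ρ e = t ∧ γ e = x).card =
      ∑ l, if t = τ l then ω l else 0) (g : Multiset I → ℕ) :
    ∑ e with γ e = x, g (rowType ρ e) = ∑ l, ω l * g (τ l) := by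
  classical
  rw [← Finset.sum_fiberwise_of_maps_to (s := Finset.univ.filter fun e => γ e = x)
    (t := (Finset.univ : Finset (Finset V)).image (rowType ρ) ∪ Finset.univ.image τ)
    (g := rowType ρ) (fun e _ => Finset.mem_union_left _
      (Finset.mem_image_of_mem _ (Finset.mem_univ e)))]
  have h1 : ∀ t, ∑ e ∈ Finset.univ.filter (fun e => γ e = x) with rowType ρ e = t,
      g (rowType ρ e) = ∑ l, if t = τ l then ω l * g (τ l) else 0 := by
    intro t
    rw [Finset.filter_filter, Finset.sum_congr rfl (g := fun _ => g t), Finset.sum_const,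
      smul_eq_mul]
    · have hcomm : (Finset.univ.filter fun e => γ e = x ∧ rowType ρ e = t) =
          Finset.univ.filter fun e => rowType ρ e = t ∧ γ e = x :=
        Finset.filter_congr fun e _ => and_comm
      rw [hcomm, h, Finset.sum_mul]
      refine Finset.sum_congr rfl fun l _ => ?_
      split_ifs with hl
      · rw [hl]
      · simp
    · intro e he
      rw [(Finset.mem_filter.1 he).2.2]
  simp only [h1]
  rw [Finset.sum_comm]
  refine Finset.sum_congr rfl fun l _ => ?_
  rw [Finset.sum_ite_eq', if_pos]
  exact Finset.mem_union_right _ (Finset.mem_image_of_mem _ (Finset.mem_univ l))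

/-- There are `h ^ |e|` transversals of a set `e` of rows of size `h`. -/
theorem pow_le_card_transversals {V I : Type*} [Fintype V] [DecidableEq V] [DecidableEq I]
    {h : ℕ} (φ : I × Fin h ≃ V) (e : Finset I) :
    h ^ e.card ≤
      (Finset.univ.filter fun A => rowType (fun v => (φ.symm v).1) A = e.val).card := by
  have hcard : h ^ e.card = (Finset.univ : Finset (e → Fin h)).card := by simp
  have hinj : ∀ s : e → Fin h, Function.Injective fun i : e => φ (i.1, s i) := fun s i j hij =>
    Subtype.ext (congrArg Prod.fst (φ.injective hij))
  rw [hcard]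
  refine Finset.card_le_card_of_injOn (fun s => e.attach.map ⟨_, hinj s⟩) ?_ ?_
  · intro s _
    refine Finset.mem_coe.2 (Finset.mem_filter.2 ⟨Finset.mem_univ _, ?_⟩)
    simp only [rowType, Finset.map_val, Multiset.map_map, Function.Embedding.coeFn_mk,
      Function.comp_def, Equiv.symm_apply_apply]
    exact Multiset.attach_map_val e.val
  · intro s _ s' _ hs
    funext i
    have hi : φ (i.1, s i) ∈ e.attach.map ⟨_, hinj s⟩ :=
      Finset.mem_map.2 ⟨i, Finset.mem_attach _ _, rfl⟩
    have hs : e.attach.map ⟨_, hinj s⟩ = e.attach.map ⟨_, hinj s'⟩ := hs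
    rw [hs, Finset.mem_map] at hi
    obtain ⟨j, -, hj⟩ := hi
    have := φ.injective hj
    rw [Prod.mk.injEq] at this
    obtain ⟨h1, h2⟩ := this
    have h3 := Subtype.ext h1
    subst h3
    exact h2.symm

/-- There are `h.choose a` subsets of size `a` in a row of size `h`. -/
theorem choose_le_card_in_row {V I : Type*} [Fintype V] [DecidableEq V] [DecidableEq I]
    {h : ℕ} (φ : I × Fin h ≃ V) (i : I) (a : ℕ) :
    h.choose a ≤ (Finset.univ.filter fun A =>
      rowType (fun v => (φ.symm v).1) A = Multiset.replicate a i).card := by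
  have hcard : h.choose a = (Finset.powersetCard a (Finset.univ : Finset (Fin h))).card := by
    simp
  have hinj : Function.Injective fun s : Fin h => φ (i, s) := fun s s' hs => by
    simpa using φ.injective hs
  rw [hcard]
  refine Finset.card_le_card_of_injOn (fun B => B.map ⟨fun s => φ (i, s), hinj⟩) ?_ ?_
  · intro B hB
    rw [Finset.mem_coe, Finset.mem_powersetCard] at hB
    refine Finset.mem_coe.2 (Finset.mem_filter.2 ⟨Finset.mem_univ _, ?_⟩)
    simp [rowType, Multiset.map_map, Multiset.map_const', hB]
  · intro B _ B' _ hB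
    exact Finset.map_injective _ hB

/-- The colouring underlying the construction. The rows are the sets `φ ({i} × Fin h)`, and every
set that gets a colour is either a transversal of `c` rows or a `(c + 1)`-subset of a row. -/
theorem exists_row_colouring {V : Type*} [Fintype V] [DecidableEq V] {c m h p r D : ℕ}
    (φ : Fin m × Fin h ≃ V) (hc : 2 ≤ c) (hm : 0 < m) (hcm : c ∣ m)
    (b : Fin p → Fin (m / c) → ℕ)
    (hb : ∀ j l, (c + 1) * b j l ≤ h) (hbr : ∀ j, c * ∑ l, b j l = r)
    (hbc : ∀ l, ∑ j, (h - (c + 1) * b j l) ≤ h ^ c) (hbD : ∀ l, ∑ j, b j l ≤ D)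
    (hD : (m - 1).choose (c - 1) * D ≤ h.choose (c + 1)) :
    ∃ γ : Finset V → Option (Fin ((m - 1).choose (c - 1)) × Fin p),
      (∀ x v, ∃! A, γ A = some x ∧ v ∈ A) ∧
      (∀ A x, γ A = some x →
        (A.card = c ∧ ∀ v ∈ A, ∀ v' ∈ A, (φ.symm v).1 = (φ.symm v').1 → v = v') ∨
        (A.card = c + 1 ∧ ∃ i, ∀ v ∈ A, (φ.symm v).1 = i)) ∧
      ∀ x, (Finset.univ.filter fun A => γ A = some x ∧ A.card = c + 1).card = r := by
  obtain ⟨β, hβc, hβ⟩ := baranyai hm (by omega : 0 < c) hcm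
  choose edge hedge hedge' using hβ
  simp only at hedge'
  -- sums over points are sums over the edges of a parallel class
  have hpoints : ∀ f (g : Finset (Fin m) → ℕ),
      ∑ i, g (edge f i) = c * ∑ e with β e = some f, g e := by
    intro f g
    have : ∀ i, g (edge f i) = ∑ e with β e = some f, if i ∈ e then g e else 0 := by
      intro i
      rw [Finset.sum_eq_single (edge f i)]
      · simp [(hedge f i).2]
      · intro e he hne
        rw [if_neg]
        intro hi
        exact hne (hedge' f i e ⟨(Finset.mem_filter.1 he).2, hi⟩)
      · intro hne
        exact absurd (by simp [(hedge f i).1]) hne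
    simp only [this]
    rw [Finset.sum_comm, Finset.mul_sum]
    refine Finset.sum_congr rfl fun e he => ?_
    rw [← Finset.sum_filter, Finset.sum_const, smul_eq_mul]
    congr 1
    rw [← hβc e f (Finset.mem_filter.1 he).2]
    congr 1
    ext i; simp
  have hclass : ∀ f, Fintype.card {e // β e = some f} = m / c := by
    intro f
    have := hpoints f fun _ => 1
    simp only [Finset.sum_const, Finset.card_univ, Fintype.card_fin, smul_eq_mul, mul_one] at this
    rw [Fintype.card_subtype]
    exact (Nat.div_eq_of_eq_mul_right (by omega) this).symm
  let idx : ∀ f, {e // β e = some f} ≃ Fin (m / c) := fun f =>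
    Fintype.equivFinOfCardEq (hclass f)
  let a : Fin ((m - 1).choose (c - 1)) → Fin p → Finset (Fin m) → ℕ := fun f j e =>
    if he : β e = some f then b j (idx f ⟨e, he⟩) else 0
  have ha : ∀ f e (he : β e = some f), ∀ j, a f j e = b j (idx f ⟨e, he⟩) := fun f e he j => by
    simp only [a, dif_pos he]
  have hasum : ∀ f j, c * ∑ e with β e = some f, a f j e = r := by
    intro f j
    rw [← hbr j, ← Equiv.sum_comp (idx f)]
    congr 1
    rw [Finset.sum_subtype (p := fun e => β e = some f) _ (by simp)]
    exact Finset.sum_congr rfl fun e _ => ha f e.1 e.2 j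
  -- The labels are the two kinds of admissible row type: transversals of an edge, and `(c +
  -- 1)`-sets inside a row. The weights `ω` are the numbers of each in one partition.
  let τ : Finset (Fin m) ⊕ Fin m → Multiset (Fin m) :=
    Sum.elim Finset.val (Multiset.replicate (c + 1))
  let ω : Fin ((m - 1).choose (c - 1)) × Fin p → Finset (Fin m) ⊕ Fin m → ℕ := fun x =>
    Sum.elim (fun e => if β e = some x.1 then h - (c + 1) * a x.1 x.2 e else 0)
      (fun i => a x.1 x.2 (edge x.1 i))
  have hne : ∀ (e : Finset (Fin m)) i, e.val ≠ Multiset.replicate (c + 1) i := by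
    intro e i he
    have := e.nodup
    rw [he, Multiset.nodup_iff_count_le_one] at this
    have := this i
    rw [Multiset.count_replicate_self] at this
    omega
  obtain ⟨γ₀, hγ₀⟩ := exists_prescribed_colouring (rowType fun v => (φ.symm v).1)
    (fun t x => ∑ l, if t = τ l then ω x l else 0) (by
      intro t
      simp only [Fintype.sum_sum_type, τ, ω, Sum.elim_inl, Sum.elim_inr]
      by_cases h1 : ∃ i, t = Multiset.replicate (c + 1) i
      · obtain ⟨i, rfl⟩ := h1
        refine le_trans (le_trans ?_ hD) (choose_le_card_in_row φ i (c + 1))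
        simp only [(hne _ _).symm, if_false, Finset.sum_const_zero, zero_add,
          Multiset.replicate_right_inj (Nat.succ_ne_zero c), Finset.sum_ite_eq, Finset.mem_univ,
          if_true]
        rw [Fintype.sum_prod_type]
        refine le_trans (Finset.sum_le_card_nsmul _ _ D fun f _ => ?_) (by simp)
        simp only [ha f _ (hedge f i).1]
        exact hbD _
      push Not at h1
      simp only [h1, if_false, Finset.sum_const_zero, add_zero]
      by_cases h2 : ∃ e : Finset (Fin m), t = e.val
      · obtain ⟨e, rfl⟩ := h2
        simp only [Finset.val_inj, Finset.sum_ite_eq, Finset.mem_univ, if_true]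
        rcases hf : β e with _ | f
        · simp
        · refine le_trans (le_trans ?_ (hbc (idx f ⟨e, hf⟩)))
            (hβc e f hf ▸ pow_le_card_transversals φ e)
          -- The edge lies in one parallel class only, so just `p` partitions compete for its `h ^
          -- c` transversals.
          rw [Fintype.sum_prod_type, Finset.sum_eq_single f]
          · simp [ha f e hf]
          · intro f' _ hf'
            simp [Ne.symm hf']
          · simp
      · push Not at h2
        simp [h2])
  obtain ⟨γ, hγ, hγu⟩ := exists_regular (fun v => (φ.symm v).1) γ₀ (by
    intro x v
    rw [sum_class_eq_sum_labels _ γ₀ (some x) τ (ω x) (fun t => hγ₀ t x)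
      fun t => t.count (φ.symm v).1]
    have hrow : (Finset.univ.filter fun w => (φ.symm w).1 = (φ.symm v).1).card = h := by
      refine Eq.symm ((Finset.card_fin h).symm.trans ?_)
      refine Finset.card_nbij' (fun s => φ ((φ.symm v).1, s)) (fun w => (φ.symm w).2)
        ?_ ?_ ?_ ?_
      · intro s _; simp
      · intro w _; simp
      · intro s _; simp
      · intro w hw
        have : (φ.symm w).1 = (φ.symm v).1 := by simpa using hw
        simp [← this]
    rw [hrow]
    generalize (φ.symm v).1 = i
    simp only [Fintype.sum_sum_type, τ, ω, Sum.elim_inl, Sum.elim_inr]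
    -- Row `i` meets the transversals of its own edge once each and its `(c + 1)`-sets `c + 1` times
    -- each, in total `h`.
    rw [Finset.sum_eq_single (edge x.1 i), Finset.sum_eq_single i]
    · have h1 := hedge x.1 i
      rw [Multiset.count_replicate_self, Multiset.count_eq_one_of_mem (Finset.nodup _) h1.2,
        if_pos h1.1, mul_one, mul_comm (a _ _ _)]
      have := hb x.2 (idx x.1 ⟨_, h1.1⟩)
      rw [← ha x.1 _ h1.1] at this
      omega
    · intro i' _ hi'
      rw [Multiset.count_replicate, if_neg hi', mul_zero]
    · simp
    · intro e _ he
      split_ifs with h1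
      · rw [Multiset.count_eq_zero_of_notMem, mul_zero]
        exact fun hi => he (hedge' x.1 i e ⟨h1, hi⟩)
      · simp
    · simp)
  have hγ' : ∀ t x, (Finset.univ.filter fun A => rowType (fun v => (φ.symm v).1) A = t ∧
      γ A = some x).card = ∑ l, if t = τ l then ω x l else 0 := fun t x =>
    (hγ t (some x)).trans (hγ₀ t x)
  have hcardω : ∀ x e, (ω x (Sum.inl e)) ≠ 0 → e.card = c := by
    intro x e he
    simp only [ω, Sum.elim_inl] at he
    split_ifs at he with h1
    · exact hβc e _ h1
    · exact absurd rfl he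
  have hcardτ : ∀ A : Finset V, Multiset.card (rowType (fun v => (φ.symm v).1) A) = A.card :=
    fun A => by simp [rowType]
  refine ⟨γ, hγu, fun A x hA => ?_, fun x => ?_⟩
  · have h1 := hγ' (rowType (fun v => (φ.symm v).1) A) x
    have h2 : 0 < (Finset.univ.filter fun A' => rowType (fun v => (φ.symm v).1) A' =
      rowType (fun v => (φ.symm v).1) A ∧ γ A' = some x).card :=
      Finset.card_pos.2 ⟨A, by simp [hA]⟩
    rw [h1] at h2
    obtain ⟨l, -, hl⟩ := Finset.exists_ne_zero_of_sum_ne_zero h2.ne'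
    have h3 : rowType (fun v => (φ.symm v).1) A = τ l := by
      by_contra h; simp [h] at hl
    rw [if_pos h3] at hl
    rcases l with e | i
    · left
      refine ⟨?_, ?_⟩
      · rw [← hcardτ, h3, ← hcardω x e hl]; rfl
      · have h4 : (A.val.map fun v => (φ.symm v).1).Nodup := by
          change (rowType (fun v => (φ.symm v).1) A).Nodup
          rw [h3]; exact e.nodup
        intro v hv v' hv' hvv'
        exact Multiset.inj_on_of_nodup_map h4 v hv v' hv' hvv'
    · right
      refine ⟨?_, i, ?_⟩
      · rw [← hcardτ, h3]; simp [τ]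
      · intro v hv
        have : (φ.symm v).1 ∈ rowType (fun v => (φ.symm v).1) A := Multiset.mem_map_of_mem _ hv
        rw [h3] at this
        exact Multiset.eq_of_mem_replicate this
  · have h1 := sum_class_eq_sum_labels _ γ (some x) τ (ω x) (fun t => hγ' t x)
      fun t => if Multiset.card t = c + 1 then 1 else 0
    simp only [hcardτ] at h1
    rw [← Finset.card_filter, Finset.filter_filter] at h1
    rw [h1, Fintype.sum_sum_type]
    have h2 : ∀ e, ω x (Sum.inl e) * (if Multiset.card (τ (Sum.inl e)) = c + 1 then 1 else 0)
        = 0 := by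
      intro e
      by_cases he : ω x (Sum.inl e) = 0
      · rw [he, zero_mul]
      · have := hcardω x e he
        rw [if_neg, mul_zero]
        simp only [τ, Sum.elim_inl, Finset.card_val]
        omega
    simp only [h2, Finset.sum_const_zero, zero_add]
    simp only [τ, ω, Sum.elim_inr, Multiset.card_replicate, if_true, mul_one]
    rw [hpoints x.1 (a x.1 x.2), hasum]

/-! ### From colourings to Sperner partition systems. -/

/-- A colouring whose colour classes are partitions into `c`-sets that meet each row at most once
and `(c + 1)`-sets inside rows is an almost uniform Sperner partition system. -/
theorem exists_system_of_colouring {n c k r : ℕ} {I X : Type*} [Fintype X] [DecidableEq X]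
    (hn : n = c * k + r) (hc : 2 ≤ c) (hr : 1 ≤ r) (hrk : r < k) (ρ : Fin n → I)
    (γ : Finset (Fin n) → Option X) (hγ : ∀ x v, ∃! A, γ A = some x ∧ v ∈ A)
    (hγρ : ∀ A x, γ A = some x → (A.card = c ∧ ∀ v ∈ A, ∀ v' ∈ A, ρ v = ρ v' → v = v') ∨
        (A.card = c + 1 ∧ ∃ i, ∀ v ∈ A, ρ v = i))
    (hγr : ∀ x, (Finset.univ.filter fun A => γ A = some x ∧ A.card = c + 1).card = r) :
    ∃ S : Finset (Finpartition (Finset.univ : Finset (Fin n))),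
      IsSpernerPartitionSystem n k S ∧ IsAlmostUniform n k S ∧ S.card = Fintype.card X := by
  classical
  have hcard : ∀ A x, γ A = some x → A.card = c ∨ A.card = c + 1 := fun A x h =>
    (hγρ A x h).imp And.left And.left
  let P : X → Finpartition (Finset.univ : Finset (Fin n)) := fun x =>
    Finpartition.ofExistsUnique (Finset.univ.filter fun A => γ A = some x)
      (fun A _ => Finset.subset_univ A)
      (fun v _ => by simpa using hγ x v)
      (fun h => by
        have := hcard ∅ x (by simpa using h)
        simp at this; omega)
  have hparts : ∀ x, (P x).parts = Finset.univ.filter fun A => γ A = some x := fun x => rfl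
  have hmem : ∀ x A, A ∈ (P x).parts ↔ γ A = some x := fun x A => by simp [hparts]
  have hPinj : Function.Injective P := by
    intro x y hxy
    obtain ⟨A, hA, -⟩ := hγ x (⟨0, by omega⟩ : Fin n)
    have := (hmem y A).1 (hxy ▸ (hmem x A).2 hA.1)
    rw [hA.1] at this
    exact Option.some.inj this
  have hk0 : (0 : ℚ) < k := by exact_mod_cast (by omega : 0 < k)
  have hk : 0 < k := by omega
  have hfloor : ⌊(n : ℚ) / (k : ℚ)⌋₊ = c := by
    rw [Nat.floor_div_natCast, Nat.floor_natCast, hn]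
    rw [mul_comm, Nat.mul_add_div hk, Nat.div_eq_of_lt hrk, add_zero]
  have hceil : ⌈(n : ℚ) / (k : ℚ)⌉₊ = c + 1 := by
    rw [Nat.ceil_eq_iff (by omega)]
    have h1 : (n : ℚ) = c * k + r := by exact_mod_cast hn
    have h2 : (r : ℚ) < k := by exact_mod_cast hrk
    have h3 : (1 : ℚ) ≤ r := by exact_mod_cast hr
    rw [lt_div_iff₀ hk0, div_le_iff₀ hk0, h1]
    push_cast
    constructor
    · linarith
    · linarith
  refine ⟨Finset.univ.image P, ⟨?_, ?_⟩, ?_, ?_⟩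
  · simp only [Finset.mem_image, Finset.mem_univ, true_and, forall_exists_index]
    rintro _ x rfl
    have hsum := (P x).sum_card_parts
    rw [Finset.card_univ, Fintype.card_fin] at hsum
    have h1 : (P x).parts.filter (fun A => A.card = c + 1) =
        Finset.univ.filter fun A => γ A = some x ∧ A.card = c + 1 := by
      rw [hparts, Finset.filter_filter]
    have h2 := Finset.card_filter_add_card_filter_not (s := (P x).parts)
      (fun A => A.card = c + 1)
    have h3 : ∑ A ∈ (P x).parts with A.card = c + 1, A.card = r * (c + 1) := by
      rw [Finset.sum_congr rfl fun A hA => (Finset.mem_filter.1 hA).2, Finset.sum_const, h1, hγr,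
        smul_eq_mul]
    have h4 : ∑ A ∈ (P x).parts with ¬ A.card = c + 1, A.card =
        ((P x).parts.filter fun A => ¬ A.card = c + 1).card * c := by
      rw [← smul_eq_mul, ← Finset.sum_const]
      refine Finset.sum_congr rfl fun A hA => ?_
      rw [Finset.mem_filter] at hA
      exact (hcard A x ((hmem x A).1 hA.1)).resolve_right hA.2
    rw [← Finset.sum_filter_add_sum_filter_not _ (fun A => A.card = c + 1), h3, h4] at hsum
    rw [h1, hγr] at h2
    rw [← h2]
    refine Nat.eq_of_mul_eq_mul_left (by omega : 0 < c) ?_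
    linarith [hsum.trans hn]
  · simp only [Finset.mem_image, Finset.mem_univ, true_and, forall_exists_index]
    rintro _ x rfl _ y rfl hne A hA B hB hAB
    rw [hmem] at hA hB
    have hxy : x ≠ y := fun h => hne (h ▸ rfl)
    have heq : A.card = B.card → False := fun h => by
      rw [Finset.eq_of_subset_of_card_le hAB h.ge, hB] at hA
      exact hxy (Option.some.inj hA).symm
    have hle := Finset.card_le_card hAB
    -- Sets of equal size would coincide and share a colour. A `c`-set inside a `(c + 1)`-set would
    -- have two points in one row, as `c ≥ 2`.
    rcases hγρ A x hA with ⟨h1, h2⟩ | ⟨h1, h2⟩ <;> rcases hγρ B y hB with ⟨h3, h4⟩ | ⟨h3, h4⟩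
    · exact heq (h1.trans h3.symm)
    · obtain ⟨i, hi⟩ := h4
      obtain ⟨v, hv, v', hv', hvv'⟩ := Finset.one_lt_card.1 (by omega : 1 < A.card)
      exact hvv' (h2 v hv v' hv' ((hi v (hAB hv)).trans (hi v' (hAB hv')).symm))
    · omega
    · exact heq (h1.trans h3.symm)
  · simp only [IsAlmostUniform, Finset.mem_image, Finset.mem_univ, true_and, forall_exists_index]
    rintro _ x rfl A hA
    rw [hfloor, hceil]
    exact hcard A x ((hmem x A).1 hA)
  · rw [Finset.card_image_of_injective _ hPinj, Finset.card_univ]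

/-- The construction of a Sperner partition system from `m` rows of size `h`: the `j`-th partition
of a parallel class of the `c`-subsets of the rows uses `b j l` sets of size `c + 1` in each row of
the `l`-th edge. -/
theorem exists_system {n c k r m h p D : ℕ} (hn : n = c * k + r) (hc : 2 ≤ c) (hr : 1 ≤ r)
    (hrk : r < k) (hnm : n = m * h) (hcm : c ∣ m) (b : Fin p → Fin (m / c) → ℕ)
    (hb : ∀ j l, (c + 1) * b j l ≤ h) (hbr : ∀ j, c * ∑ l, b j l = r)
    (hbc : ∀ l, ∑ j, (h - (c + 1) * b j l) ≤ h ^ c) (hbD : ∀ l, ∑ j, b j l ≤ D)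
    (hD : (m - 1).choose (c - 1) * D ≤ h.choose (c + 1)) :
    ∃ S : Finset (Finpartition (Finset.univ : Finset (Fin n))),
      IsSpernerPartitionSystem n k S ∧ IsAlmostUniform n k S ∧
        S.card = p * (m - 1).choose (c - 1) := by
  have hm : 0 < m := Nat.pos_of_ne_zero fun h0 => by subst h0; omega
  obtain ⟨γ, h1, h2, h3⟩ := exists_row_colouring
    (finProdFinEquiv.trans (finCongr hnm.symm)) hc hm hcm b hb hbr hbc hbD hD
  obtain ⟨S, hS1, hS2, hS3⟩ := exists_system_of_colouring hn hc hr hrk _ γ h1 h2 h3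
  exact ⟨S, hS1, hS2, by simpa [mul_comm] using hS3⟩

/-! ### Even distribution and numerical estimates. -/

/-- Hermite's identity: raising `n` by one drops the term `n / d` and gains `(n + d) / d = n / d +
1`. -/
theorem sum_range_add_div (n d : ℕ) (hd : 0 < d) : ∑ l ∈ Finset.range d, (n + l) / d = n := by
  induction n with
  | zero =>
    refine Finset.sum_eq_zero fun l hl => ?_
    rw [zero_add, Nat.div_eq_of_lt (Finset.mem_range.1 hl)]
  | succ n ih =>
    have h1 := Finset.sum_range_succ (fun l => (n + l) / d) d
    rw [Finset.sum_range_succ', ih, Nat.add_div_right _ hd] at h1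
    simp only [add_zero] at h1
    have h2 : ∀ l, n + 1 + l = n + (l + 1) := fun l => by omega
    simp only [h2]
    omega

/-- A `p × d` matrix of natural numbers with row sums `R`, almost equal entries, and almost equal
column sums. -/
theorem exists_balanced_matrix (p R d : ℕ) (hd : 0 < d) :
    ∃ b : Fin p → Fin d → ℕ, (∀ j, ∑ l, b j l = R) ∧
      (∀ q, R ≤ d * q → ∀ j l, b j l ≤ q) ∧ ∀ l, ∑ j, b j l = (p * R + l) / d := by
  -- Column sums telescope, and row sums follow from Hermite's identity.
  refine ⟨fun j l => ((j + 1) * R + l) / d - (j * R + l) / d, ?_, ?_, ?_⟩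
  · intro j
    rw [Fin.sum_univ_eq_sum_range (fun l => ((j + 1) * R + l) / d - (j * R + l) / d) d,
      Finset.sum_tsub_distrib, sum_range_add_div _ _ hd, sum_range_add_div _ _ hd, add_one_mul,
      Nat.add_sub_cancel_left]
    intro l _
    exact Nat.div_le_div_right (by nlinarith)
  · intro q hq j l
    have h1 : ((j + 1) * R + l : ℕ) / d ≤ (j * R + l + d * q) / d :=
      Nat.div_le_div_right (by nlinarith)
    rw [Nat.add_mul_div_left _ _ hd] at h1
    simp only
    omega
  · intro l
    rw [Fin.sum_univ_eq_sum_range (fun j => ((j + 1) * R + l) / d - (j * R + l) / d) p]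
    have h0 : (0 * R + l) / d = 0 := by rw [zero_mul, zero_add, Nat.div_eq_of_lt l.2]
    have := Finset.sum_range_tsub (f := fun j => (j * R + l) / d)
      (fun i j hij => Nat.div_le_div_right (Nat.add_le_add_right (Nat.mul_le_mul_right R hij) _)) p
    rw [h0, Nat.sub_zero] at this
    exact this

/-- Choosing inside one of `d` disjoint blocks of size `h` is one way of choosing from their union;
used when rows are merged. -/
theorem mul_choose_succ_le (d h a : ℕ) : d * h.choose (a + 1) ≤ (h * d).choose (a + 1) := by
  have hadd : ∀ x y : ℕ, x.choose (a + 1) + y.choose (a + 1) ≤ (x + y).choose (a + 1) := by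
    intro x y
    induction y with
    | zero => simp
    | succ y ih =>
      rw [← add_assoc, Nat.choose_succ_succ', Nat.choose_succ_succ']
      have := Nat.choose_le_choose a (by omega : y ≤ x + y)
      omega
  induction d with
  | zero => simp
  | succ d ih =>
    rw [add_one_mul, mul_add_one]
    exact (Nat.add_le_add_right ih _).trans (hadd _ _)

theorem mul_two_mul_add_one_le_factorial {c : ℕ} (hc : 3 ≤ c) :
    c * (2 * c + 1) ≤ (c + 1).factorial := by
  induction c, hc using Nat.le_induction with
  | base => decide
  | succ c hc ih =>
    rw [Nat.factorial_succ]
    nlinarith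

/-- The number of `c`-sets that are needed when the `(c + 1)`-sets almost fill the rows. -/
theorem choose_mul_le_mul_pow {c d h q s : ℕ} (hc : 2 ≤ c) (hd : 2 ≤ d) (hq : 0 < q)
    (hh : h = (c + 1) * q + s) (hs : s ≤ c) :
    d * s * h.choose (c + 1) ≤ q * (h * d) ^ c := by
  have h1 : h.choose (c + 1) * (c + 1).factorial ≤ h ^ (c + 1) := by
    rw [mul_comm, ← Nat.descFactorial_eq_factorial_mul_choose]
    exact Nat.descFactorial_le_pow h (c + 1)
  have h2 : s * h ≤ q * (c * (2 * c + 1)) := by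
    have : h ≤ q * (2 * c + 1) := by nlinarith
    calc s * h ≤ c * (q * (2 * c + 1)) := Nat.mul_le_mul hs this
      _ = _ := by ring
  have h3 : c * (2 * c + 1) ≤ (c + 1).factorial * d ^ (c - 1) := by
    -- For `c = 2` the factorial alone is too small (`10 > 6`), and the factor `d ≥ 2` makes up for
    -- it.
    rcases hc.eq_or_lt with rfl | hc
    · simp [Nat.factorial]; omega
    · exact (mul_two_mul_add_one_le_factorial hc).trans
        (Nat.le_mul_of_pos_right _ (pow_pos (by omega) _))
  refine Nat.le_of_mul_le_mul_right ?_ (Nat.factorial_pos (c + 1))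
  calc d * s * h.choose (c + 1) * (c + 1).factorial
      = d * s * (h.choose (c + 1) * (c + 1).factorial) := by ring
    _ ≤ d * s * h ^ (c + 1) := Nat.mul_le_mul_left _ h1
    _ = d * h ^ c * (s * h) := by ring
    _ ≤ d * h ^ c * (q * ((c + 1).factorial * d ^ (c - 1))) :=
        Nat.mul_le_mul_left _ (h2.trans (Nat.mul_le_mul_left _ h3))
    _ = q * (h ^ c * (d ^ (c - 1) * d)) * (c + 1).factorial := by ring
    _ = q * (h * d) ^ c * (c + 1).factorial := by
        rw [← pow_succ, Nat.sub_add_cancel (by omega), mul_pow]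

/-! ### Merged rows and the final choice of parameters. -/

/-- When the `(c + 1)`-sets do not fit into `c * d` rows of size `h`, it is enough to use `c` rows
of size `h * d`. -/
theorem exists_system_of_tight {n c k r d h N R : ℕ} (hn : n = c * k + r) (hc : 2 ≤ c) (hr : 1 ≤ r)
    (hrk : r < k) (hnm : n = h * (c * d)) (hrR : r = c * R) (hd : 0 < d)
    (hh : 0 < h.choose (c + 1)) (hN : N * R ≤ d * h.choose (c + 1))
    (htight : d * (h / (c + 1)) < R) :
    ∃ S : Finset (Finpartition (Finset.univ : Finset (Fin n))),
      IsSpernerPartitionSystem n k S ∧ IsAlmostUniform n k S ∧ S.card = N := by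
  have hc0 : 0 < c := by omega
  have hrow : h * d = k + R := by
    refine Nat.eq_of_mul_eq_mul_left hc0 ?_
    rw [hn, hrR] at hnm
    linarith
  have hR : (c + 1) * R ≤ h * d := by rw [hrow, add_one_mul, ← hrR]; omega
  have hch : c + 1 ≤ h := by
    by_contra hlt
    rw [Nat.choose_eq_zero_of_lt (by omega)] at hh
    exact lt_irrefl _ hh
  have hq : 0 < h / (c + 1) := Nat.div_pos hch (by omega)
  have hmod := Nat.div_add_mod h (c + 1)
  have hs := Nat.mod_lt h (by omega : 0 < c + 1)
  have hd2 : 2 ≤ d := by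
    by_contra hlt
    obtain rfl : d = 1 := by omega
    rw [mul_one] at hR
    have : R ≤ h / (c + 1) := (Nat.le_div_iff_mul_le (by omega : 0 < c + 1)).2 (by rwa [mul_comm])
    omega
  have hkey := choose_mul_le_mul_pow hc hd2 hq hmod.symm (by omega)
  generalize h / (c + 1) = q at *
  generalize h % (c + 1) = s at *
  have hpow : N * (h * d - (c + 1) * R) ≤ (h * d) ^ c := by
    -- Tightness leaves at most the remainders `s` of the `d` old rows to be covered by
    -- transversals.
    have h1 : h * d - (c + 1) * R ≤ d * s := by
      have : h * d = (c + 1) * (d * q) + d * s := by rw [← hmod]; ring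
      have := Nat.mul_le_mul_left (c + 1) htight.le
      omega
    have h2 : N * q ≤ h.choose (c + 1) := by
      refine Nat.le_of_mul_le_mul_left ?_ hd
      calc d * (N * q) = N * (d * q) := by ring
        _ ≤ N * R := Nat.mul_le_mul_left _ htight.le
        _ ≤ _ := hN
    refine Nat.le_of_mul_le_mul_left ?_ hq
    calc q * (N * (h * d - (c + 1) * R)) ≤ q * (N * (d * s)) := by gcongr
      _ = d * s * (N * q) := by ring
      _ ≤ d * s * h.choose (c + 1) := Nat.mul_le_mul_left _ h2
      _ ≤ _ := hkey
  -- With `c` rows there is one edge and one parallel class, so all `N` partitions come from it,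
  -- each with `R` sets of size `c + 1` in every row.
  obtain ⟨S, h1, h2, h3⟩ := exists_system (m := c) (h := h * d) (p := N) (D := N * R) hn hc hr hrk
    (by rw [hnm]; ring) dvd_rfl (fun _ _ => R) (fun _ _ => hR)
    (fun _ => by simp [Nat.div_self hc0, hrR]) (fun _ => by simpa using hpow)
    (fun _ => by simp)
    (by rw [Nat.choose_self, one_mul]; exact hN.trans (mul_choose_succ_le d h c))
  exact ⟨S, h1, h2, by rw [h3, Nat.choose_self, mul_one]⟩

/-- The numerical conditions on `p` under which balanced numbers of `(c + 1)`-sets can be used. -/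
theorem exists_bound_of_eq_min {c k r m h p : ℕ} (hc : 2 ≤ c) (hr : 1 ≤ r) (hrk : r < k)
    (hn : h * m = c * k + r) (hm : 0 < m) (hcm : c ≤ m)
    (hp : (p : ℤ) = min (boundP1 m h c k r) (boundP2 m h c r) ∨
      ((p : ℤ) = min (boundP1' m h c k r) (boundP2' m h c r) ∧ m ∣ p * r)) :
    ∃ D, (m - 1).choose (c - 1) * D ≤ h.choose (c + 1) ∧ p * r ≤ m * D ∧
      ∀ B, p * r < m * (B + 1) → p * h ≤ h ^ c + (c + 1) * B := by
  have hM : 0 < (m - 1).choose (c - 1) := Nat.choose_pos (by omega)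
  have hMq : (0 : ℚ) < (m - 1).choose (c - 1) := by exact_mod_cast hM
  have hrq : (0 : ℚ) < r := by exact_mod_cast hr
  have hkr : (0 : ℚ) < (k : ℚ) - r := by
    rw [sub_pos]; exact_mod_cast hrk
  have hcq : (0 : ℚ) < c := by exact_mod_cast (by omega : 0 < c)
  have hnq : (h : ℚ) * m = c * k + r := by exact_mod_cast hn
  have hmq : (0 : ℚ) < m := by exact_mod_cast hm
  rcases hp with hp | ⟨hp, hdvd⟩
  · have h1 : (p : ℤ) ≤ boundP1 m h c k r := hp ▸ min_le_left _ _
    have h2 : (p : ℤ) ≤ boundP2 m h c r := hp ▸ min_le_right _ _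
    rw [boundP1, Int.le_floor, le_div_iff₀ (mul_pos hcq hkr)] at h1
    rw [boundP2, Int.le_floor, div_mul_eq_mul_div, le_div_iff₀ hrq] at h2
    obtain ⟨D, hD⟩ := Int.eq_ofNat_of_zero_le (Int.floor_nonneg.2
      (div_nonneg (Nat.cast_nonneg (h.choose (c + 1))) hMq.le : (0 : ℚ) ≤ _))
    have hD' := Int.floor_le ((h.choose (c + 1) : ℚ) / ((m - 1).choose (c - 1) : ℚ))
    rw [hD] at h2 hD'
    push_cast at h1 h2 hD'
    rw [le_div_iff₀ hMq] at hD'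
    refine ⟨D, ?_, ?_, fun B hB => ?_⟩
    · rw [mul_comm]; exact_mod_cast hD'
    · exact_mod_cast h2
    -- `B` plays the role of a rounded-down column sum; the possible loss of one `(c + 1)`-set is
    -- covered by the `- c - 1` in `boundP1`.
    · have hB' : (p : ℚ) * r ≤ m * (B + 1) := by exact_mod_cast hB.le
      have : (m : ℚ) * (p * h) ≤ m * (h ^ c + (c + 1) * B) := by
        have e1 : (m : ℚ) * (p * h) = p * (c * (k - r)) + (c + 1) * (p * r) := by
          linear_combination (p : ℚ) * hnq
        have := mul_le_mul_of_nonneg_left hB' (by linarith : (0 : ℚ) ≤ c + 1)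
        rw [e1]
        linarith
      exact_mod_cast le_of_mul_le_mul_left this hmq
  · have h1 : (p : ℤ) ≤ boundP1' m h c k r := hp ▸ min_le_left _ _
    have h2 : (p : ℤ) ≤ boundP2' m h c r := hp ▸ min_le_right _ _
    rw [boundP1', Int.le_floor, le_div_iff₀ (mul_pos hcq hkr)] at h1
    rw [boundP2', Int.le_floor, le_div_iff₀ (mul_pos hrq hMq)] at h2
    push_cast at h1 h2
    obtain ⟨D, hD⟩ := hdvd
    have hDq : (p : ℚ) * r = m * D := by exact_mod_cast hD
    refine ⟨D, ?_, hD.le, fun B hB => ?_⟩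
    · have : (m : ℚ) * ((m - 1).choose (c - 1) * D) ≤ m * h.choose (c + 1) := by
        rw [← mul_assoc, mul_right_comm, ← hDq]; linarith
      exact_mod_cast le_of_mul_le_mul_left this hmq
    · rw [hD] at hB
      -- Here `p * r = m * D` exactly, so rounding costs nothing.
      have hDB : D ≤ B := Nat.lt_succ_iff.1 (Nat.lt_of_mul_lt_mul_left hB)
      have hDB' : (D : ℚ) ≤ B := by exact_mod_cast hDB
      have : (m : ℚ) * (p * h) ≤ m * (h ^ c + (c + 1) * B) := by
        have e1 : (m : ℚ) * (p * h) = p * (c * (k - r)) + (c + 1) * (m * D) := by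
          linear_combination (p : ℚ) * hnq + (c + 1) * hDq
        have := mul_le_mul_of_nonneg_left hDB' (by positivity : (0 : ℚ) ≤ m * (c + 1))
        rw [e1]
        linarith
      exact_mod_cast le_of_mul_le_mul_left this hmq

theorem lemmal (n c k r m h p : ℕ)
    (hn : n = c * k + r) (hc : 2 ≤ c) (hk : 3 ≤ k) (hr : 1 ≤ r) (hrk : r ≤ k - 1)
    (hm : 0 < m) (hh : 0 < h) (hnm : n = h * m) (hcm : c ∣ m)
    (hp : (p : ℤ) = min (boundP1 m h c k r) (boundP2 m h c r) ∨
      ((p : ℤ) = min (boundP1' m h c k r) (boundP2' m h c r) ∧ m ∣ p * r)) :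
    ∃ S : Finset (Finpartition (Finset.univ : Finset (Fin n))),
      IsSpernerPartitionSystem n k S ∧ IsAlmostUniform n k S ∧
        S.card = p * (m - 1).choose (c - 1) := by
  rcases Nat.eq_zero_or_pos p with rfl | hp0
  · exact ⟨∅, ⟨by simp, by simp⟩, by simp [IsAlmostUniform], by simp⟩
  have hrk' : r < k := by omega
  have hc0 : 0 < c := by omega
  obtain ⟨D, hD, hprD, hB⟩ := exists_bound_of_eq_min hc hr hrk' (hnm.symm.trans hn) hm
    (Nat.le_of_dvd hm hcm) hp
  obtain ⟨R, rfl⟩ : c ∣ r := by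
    rw [← Nat.dvd_add_right (dvd_mul_right c k), ← hn, hnm]
    exact dvd_mul_of_dvd_right hcm h
  obtain ⟨d, rfl⟩ := hcm
  have hd : 0 < d := Nat.pos_of_mul_pos_left hm
  have hpR : p * R ≤ d * D := by
    refine Nat.le_of_mul_le_mul_left ?_ hc0
    linarith
  -- A row holds at most `h / (c + 1)` disjoint `(c + 1)`-sets, and each partition must distribute
  -- `R` of them over the `d` edges of a class, counting one row per edge.
  by_cases hfit : R ≤ d * (h / (c + 1))
  · have hdiv : c * d / c = d := Nat.mul_div_cancel_left d hc0
    have hb : ∃ b : Fin p → Fin (c * d / c) → ℕ, (∀ j, ∑ l, b j l = R) ∧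
        (∀ q, R ≤ d * q → ∀ j l, b j l ≤ q) ∧
        ∀ l : Fin (c * d / c), (l : ℕ) < d ∧ ∑ j, b j l = (p * R + l) / d := by
      rw [hdiv]
      obtain ⟨b, hb1, hb2, hb3⟩ := exists_balanced_matrix p R d hd
      exact ⟨b, hb1, hb2, fun l => ⟨l.2, hb3 l⟩⟩
    obtain ⟨b, hb1, hb2, hb3⟩ := hb
    have hbh : ∀ j l, (c + 1) * b j l ≤ h := fun j l =>
      (Nat.mul_le_mul_left _ (hb2 (h / (c + 1)) hfit j l)).trans
        (Nat.mul_div_le h (c + 1))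
    refine exists_system hn hc hr hrk' (by rw [hnm, mul_comm]) (dvd_mul_right c d) b hbh
      (fun j => by rw [hb1]) (fun l => ?_) (fun l => ?_) hD
    · rw [Finset.sum_tsub_distrib _ fun j _ => hbh j l, ← Finset.mul_sum, (hb3 l).2]
      have hl := (hb3 l).1
      have h1 := Nat.div_add_mod (p * R + l) d
      have h2 := Nat.mod_lt (p * R + l) hd
      have := hB ((p * R + l) / d) (by nlinarith)
      simpa [Nat.sub_le_iff_le_add] using this
    · have hl := (hb3 l).1
      -- Since `l < d` and `p * R ≤ d * D`, the rounded column sum does not exceed `D`.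
      rw [(hb3 l).2, ← Nat.lt_succ_iff, Nat.div_lt_iff_lt_mul hd]
      nlinarith
  · have hDpos : 0 < D := by
      refine Nat.pos_of_ne_zero fun h0 => ?_
      rw [h0, mul_zero, Nat.le_zero] at hprD
      exact absurd hprD (Nat.mul_pos hp0 hr).ne'
    have hM : 0 < (c * d - 1).choose (c - 1) :=
      Nat.choose_pos (Nat.sub_le_sub_right (Nat.le_mul_of_pos_right c hd) 1)
    refine exists_system_of_tight hn hc hr hrk' hnm rfl hd
      ((Nat.mul_pos hM hDpos).trans_le hD) ?_ (not_le.1 hfit)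
    calc p * (c * d - 1).choose (c - 1) * R = (c * d - 1).choose (c - 1) * (p * R) := by ring
      _ ≤ (c * d - 1).choose (c - 1) * (d * D) := Nat.mul_le_mul_left _ hpR
      _ = d * ((c * d - 1).choose (c - 1) * D) := by ring
      _ ≤ _ := Nat.mul_le_mul_left _ hD
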